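/- For a topological space $X$, let $o(X)$ denote the cardinality of its topology. Call a family of sets linked if any two of its members have nonempty intersection. Let $\lambda$ be an infinite cardinal. - $\lambda$ is a caliber* for $X$ (Engelking's definition of caliber) if every set $\mathcal U$ of nonempty open subsets of $X$ with $|\mathcal U|=\lambda$ has a subset $\mathcal V\subseteq\mathcal U$ with $|\mathcal V|=\lambda$ and $\bigcap\mathcal V\neq\emptyset$. - $\lambda$ is a weak precaliber* for $X$ if every set $\mathcal U$ of nonempty open subsets of $X$ with $|\mathcal U|=\lambda$ has a linked subset $\mathcal V\subseteq\mathcal U$ with $|\mathcal V|=\lambda$. - $\lambda$ is a weak precaliber for $X$ (in Šanin's sense) if for every indexed family $\{U_\alpha:\alpha<\lambda\}$ of nonempty open subsets of $X$ (repetitions allowed) there is $J\subseteq\lambda$ with $|J|=\lambda$ such that $\{U_\alpha:\alpha\in J\}$ is linked. **Theorem.** Let $\kappa$ be an infinite cardinal with $2^{\kappa}<\aleph_\kappa$ and $\operatorname{cf}(\kappa)>\omega$. Then there is a compact Hausdorff space $X$ such that $o(X)=2^{\aleph_\kappa}=|X|$, the cardinal $\aleph_\kappa$ is a caliber* for $X$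 but not a weak precaliber for $X$, and $\kappa$ is not a weak precaliber* for $X$. -/

import Mathlib

open scoped Cardinal

universe u

/-- A family of sets is linked if any two of its members meet. -/
def IsLinked {X : Type u} (𝒱 : Set (Set X)) : Prop :=
  ∀ U ∈ 𝒱, ∀ V ∈ 𝒱, (U ∩ V).Nonempty

/-- `κ` is a weak precaliber of `X` (in the sense of Šanin): every family `{U_α : α < κ}` of
nonempty open sets, repetitions being allowed, has a linked subfamily `{U_α : α ∈ J}` for some
index set `J ⊆ κ` of cardinality `κ`. -/
def IsWeakPrecaliber (X : Type u) [TopologicalSpace X] (κ : Cardinal.{u}) : Prop :=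
  ∀ U : κ.ord.ToType → Set X, (∀ α, IsOpen (U α) ∧ (U α).Nonempty) →
    ∃ J : Set κ.ord.ToType, #J = κ ∧ IsLinked (U '' J)

/-- `κ` is a caliber* of `X` (Engelking's definition): every set of cardinality `κ` of nonempty
open sets has a subset of cardinality `κ` with nonempty intersection. -/
def IsCaliberStar (X : Type u) [TopologicalSpace X] (κ : Cardinal.{u}) : Prop :=
  ∀ 𝒰 : Set (Set X), (∀ U ∈ 𝒰, IsOpen U ∧ U.Nonempty) → #𝒰 = κ →
    ∃ 𝒱 ⊆ 𝒰, #𝒱 = κ ∧ (⋂₀ 𝒱).Nonempty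

/-- `κ` is a weak precaliber* of `X`: every set of cardinality `κ` of nonempty open sets has a
linked subset of cardinality `κ`. -/
def IsWeakPrecaliberStar (X : Type u) [TopologicalSpace X] (κ : Cardinal.{u}) : Prop :=
  ∀ 𝒰 : Set (Set X), (∀ U ∈ 𝒰, IsOpen U ∧ U.Nonempty) → #𝒰 = κ →
    ∃ 𝒱 ⊆ 𝒰, #𝒱 = κ ∧ IsLinked 𝒱

open Cardinal Set

/-! The space is the disjoint sum of the one-point compactification of a discrete space `D` of size
`κ` and the Cantor cube of weight `ℵ_κ`. The isolated points of `D` are `κ` disjoint open sets;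
repeating the `i`-th one `ℵ_i` times gives an indexed family of length `ℵ_κ` whose linked
subfamilies use a single point. Caliber* forbids repetitions, and only `2 ^ κ < ℵ_κ` open sets miss
the cube, so `ℵ_κ` of them meet it.

It remains that `ℵ_κ` is a caliber of the cube. It is singular of uncountable cofinality, so a
Δ-system argument is run twice: at regular cardinals cofinal in `ℵ_κ`, giving one root each, and
then on these `cf κ` many roots, to make them compatible. -/

/-- If every set of fewer than `c` elements of `Q` can be extended by an element of `Q` related
to all of its members, then `Q` contains `c` many pairwise related elements. -/
theorem exists_pairwise_le_mk {ι : Type u} {c : Cardinal.{u}} (Q : Set ι) (R : ι → ι → Prop)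
    (hR : ∀ a b, R a b → R b a)
    (h : ∀ J ⊆ Q, #J < c → ∃ a ∈ Q, a ∉ J ∧ ∀ b ∈ J, R a b) :
    ∃ J ⊆ Q, J.Pairwise R ∧ c ≤ #J := by
  obtain ⟨J, hJ⟩ := zorn_subset {J : Set ι | J ⊆ Q ∧ J.Pairwise R} (by
    intro C hC hchain
    refine ⟨⋃₀ C, ⟨sUnion_subset fun s hs => (hC hs).1, ?_⟩, fun s hs => subset_sUnion_of_mem hs⟩
    exact (pairwise_sUnion hchain.directedOn).2 fun s hs => (hC hs).2)
  refine ⟨J, hJ.prop.1, hJ.prop.2, ?_⟩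
  by_contra! hlt
  obtain ⟨a, haQ, haJ, ha⟩ := h J hJ.prop.1 hlt
  have hmem : insert a J ∈ {J : Set ι | J ⊆ Q ∧ J.Pairwise R} := by
    refine ⟨insert_subset haQ hJ.prop.1, hJ.prop.2.insert fun b hb _ => ⟨ha b hb, hR _ _ (ha b hb)⟩⟩
  exact haJ (hJ.le_of_ge hmem (subset_insert a J) (mem_insert a J))

/-- Among `θ` many finite sets, `θ` regular and uncountable, there are, for some root `r` and any
set `B` with fewer than `θ` elements, `θ` many which contain `r` and meet `B` only inside `r`. -/
theorem Cardinal.IsRegular.exists_root {ι E : Type u} {θ : Cardinal.{u}} (hθ : θ.IsRegular)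
    (hθ' : ℵ₀ < θ) (hι : θ ≤ #ι) (s : ι → Finset E) :
    ∃ r : Finset E, ∀ B : Set E, #B < θ → θ ≤ #{i | r ⊆ s i ∧ ∀ e ∈ s i, e ∈ B → e ∈ r} := by
  classical
  obtain ⟨n, hn⟩ : ∃ n : ℕ, θ ≤ #{i | (s i).card = n} := by
    by_contra! hcon
    have hU : (⋃ n : ULift.{u} ℕ, {i | (s i).card = n.down}) = Set.univ :=
      eq_univ_of_forall fun i => mem_iUnion.2 ⟨⟨_⟩, rfl⟩
    have hlt := (card_iUnion_lt_iff_forall_of_isRegular (ι := ULift.{u} ℕ)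
      (t := fun n => {i | (s i).card = n.down}) hθ (by simpa using hθ')).2 fun n => hcon n.down
    rw [hU, mk_univ] at hlt
    exact hlt.not_ge hι
  let S : Finset E → Set ι := fun r => {i | (s i).card = n ∧ r ⊆ s i}
  have hbound : ∀ r, θ ≤ #(S r) → r.card ≤ n := by
    intro r hr
    obtain ⟨i, hi⟩ : (S r).Nonempty := by
      rw [← nonempty_coe_sort, ← mk_ne_zero_iff]
      exact (hθ.pos.trans_le hr).ne'
    exact hi.1 ▸ Finset.card_le_card hi.2
  -- By maximality of `r`, each further point `e` lies, together with `r`, in fewer than `θ` of the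
  -- sets, so fewer than `θ` points exclude fewer than `θ` sets.
  have hmax : ∃ r, θ ≤ #(S r) ∧ ∀ r', θ ≤ #(S r') → r'.card ≤ r.card := by
    obtain ⟨r, hr, hrk⟩ := Nat.findGreatest_spec (P := fun k => ∃ r, r.card = k ∧ θ ≤ #(S r))
      (Nat.zero_le n) ⟨∅, rfl, by simpa [S] using hn⟩
    refine ⟨r, hrk, fun r' hr' => ?_⟩
    rw [hr]
    exact Nat.le_findGreatest (hbound r' hr') ⟨r', rfl, hr'⟩
  obtain ⟨r, hr, hrmax⟩ := hmax
  refine ⟨r, fun B hB => ?_⟩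
  by_contra! hlt
  have hbad : #(⋃ e ∈ B \ r, S (insert e r)) < θ := by
    rw [card_biUnion_lt_iff_forall_of_isRegular hθ ((mk_le_mk_of_subset sdiff_subset).trans_lt hB)]
    intro e he
    by_contra! hle
    have := hrmax _ hle
    rw [Finset.card_insert_of_notMem (by simpa using he.2)] at this
    omega
  have hcov : S r ⊆ {i | r ⊆ s i ∧ ∀ e ∈ s i, e ∈ B → e ∈ r} ∪ ⋃ e ∈ B \ r, S (insert e r) := by
    intro i hi
    by_cases hgood : ∀ e ∈ s i, e ∈ B → e ∈ r
    · exact Or.inl ⟨hi.2, hgood⟩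
    · push Not at hgood
      obtain ⟨e, hes, heB, her⟩ := hgood
      refine Or.inr (mem_biUnion (show e ∈ B \ r from ⟨heB, by simpa using her⟩) ⟨hi.1, ?_⟩)
      exact Finset.insert_subset hes hi.2
  exact (((mk_le_mk_of_subset hcov).trans (mk_union_le _ _)).trans_lt
    (add_lt_of_lt hθ.aleph0_le hlt hbad)).not_ge hr

theorem Cardinal.mk_biUnion_finset_lt {ι E : Type u} {θ : Cardinal.{u}} (hθ : ℵ₀ < θ) (J : Set ι)
    (hJ : #J < θ) (f : ι → Finset E) : #(⋃ i ∈ J, (f i : Set E)) < θ := by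
  refine ((mk_biUnion_le _ _).trans (mul_le_mul_right ?_ _)).trans_lt
    (mul_lt_of_lt hθ.le hJ hθ)
  exact ciSup_le' fun i => (Finset.countable_toSet _).le_aleph0

/-! ### Compatible finite partial functions -/

/-- Change the value of a pair consisting of a coordinate and a value there. -/
def flipValue {Λ : Type u} (e : Λ × Bool) : Λ × Bool := (e.1, !e.2)

@[simp] theorem flipValue_flipValue {Λ : Type u} (e : Λ × Bool) :
    flipValue (flipValue e) = e := by
  simp [flipValue]

/-- Two finite sets of prescribed values contain no contradictory prescriptions. -/
def ValuesCompatible {Λ : Type u} (p q : Finset (Λ × Bool)) : Prop := ∀ e ∈ p, flipValue e ∉ q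

theorem ValuesCompatible.symm {Λ : Type u} {p q : Finset (Λ × Bool)} (h : ValuesCompatible p q) :
    ValuesCompatible q p :=
  fun e heq hep => h _ hep (by simpa using heq)

theorem ValuesCompatible.mono {Λ : Type u} {p q p' q' : Finset (Λ × Bool)}
    (h : ValuesCompatible p q) (hp : p' ⊆ p) (hq : q' ⊆ q) : ValuesCompatible p' q' :=
  fun e he he' => h e (hp he) (hq he')

theorem mem_biUnion_image_flipValue {Λ ι : Type u} [DecidableEq (Λ × Bool)] {J : Set ι}
    {p : ι → Finset (Λ × Bool)} {e : Λ × Bool} {i : ι} (hi : i ∈ J) (he : flipValue e ∈ p i) :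
    e ∈ ⋃ i ∈ J, (((p i).image flipValue : Finset (Λ × Bool)) : Set (Λ × Bool)) :=
  mem_biUnion hi (Finset.mem_coe.2 (Finset.mem_image.2 ⟨_, he, flipValue_flipValue e⟩))

/-- A regular uncountable cardinal many finite partial functions into `Bool` contain as many
pairwise compatible ones. -/
theorem Cardinal.IsRegular.exists_pairwise_valuesCompatible {ι Λ : Type u} {θ : Cardinal.{u}}
    (hθ : θ.IsRegular) (hθ' : ℵ₀ < θ) (hι : θ ≤ #ι) (p : ι → Finset (Λ × Bool))
    (hp : ∀ i, ValuesCompatible (p i) (p i)) :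
    ∃ J : Set ι, θ ≤ #J ∧ J.Pairwise fun i j => ValuesCompatible (p i) (p j) := by
  classical
  obtain ⟨r, hr⟩ := hθ.exists_root hθ' hι p
  obtain ⟨J, -, hJ, hcard⟩ := exists_pairwise_le_mk (c := θ) {i | r ⊆ p i}
    (fun i j => ValuesCompatible (p i) (p j)) (fun _ _ h => h.symm) (by
      intro J hJ hJθ
      obtain ⟨i, hi, hiJ⟩ := sdiff_nonempty_of_mk_lt_mk (hJθ.trans_le
        (hr _ (mk_biUnion_finset_lt hθ' J hJθ fun i => (p i).image flipValue)))
      refine ⟨i, hi.1, hiJ, fun j hj e he hej => ?_⟩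
      -- A conflict at `e` puts `e` in the root, hence in `p j`, which would then contradict itself.
      exact hp j e (hJ hj (hi.2 e he (mem_biUnion_image_flipValue hj hej))) hej)
  exact ⟨J, hcard, hJ⟩

/-- A version of `Cardinal.IsRegular.exists_pairwise_valuesCompatible` for a cardinal `c` which is
the limit of regular cardinals `θ t`, along an index set whose size is regular and uncountable. -/
theorem exists_pairwise_valuesCompatible_of_limit {ι Λ T : Type u} {c : Cardinal.{u}}
    (hT : (#T).IsRegular) (hT' : ℵ₀ < #T) (hTc : #T < c) (θ : T → Cardinal.{u})
    (hθ : ∀ t, (θ t).IsRegular) (hθc : ∀ t, θ t ≤ c)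
    (hlim : ∀ I : Set T, #T ≤ #I → ∀ ν < c, ∃ t ∈ I, ν < θ t) (hθ' : ∀ t, ℵ₀ < θ t)
    (hι : c ≤ #ι) (p : ι → Finset (Λ × Bool)) (hp : ∀ i, ValuesCompatible (p i) (p i)) :
    ∃ J : Set ι, c ≤ #J ∧ J.Pairwise fun i j => ValuesCompatible (p i) (p j) := by
  classical
  choose F hF using fun t => le_mk_iff_exists_set.1 ((hθc t).trans hι)
  choose r hr using fun t => (hθ t).exists_root (hθ' t) (hF t).ge fun i : F t => p i
  have hrc : ∀ t, ValuesCompatible (r t) (r t) := by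
    intro t
    have hne := (hθ t).pos.trans_le (hr t ∅ (by simpa using (hθ t).pos))
    obtain ⟨⟨i, hi⟩⟩ := mk_ne_zero_iff.1 hne.ne'
    exact (hp i).mono hi.1 hi.1
  obtain ⟨I, hI, hIc⟩ := hT.exists_pairwise_valuesCompatible hT' le_rfl r hrc
  let R : Set (Λ × Bool) :=
    ⋃ t ∈ I, ((r t ∪ (r t).image flipValue : Finset (Λ × Bool)) : Set (Λ × Bool))
  have hRmem : ∀ t ∈ I, ∀ e ∈ r t, e ∈ R := fun t ht e he =>
    mem_biUnion ht (Finset.mem_coe.2 (Finset.mem_union_left _ he))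
  have hRflip : ∀ t ∈ I, ∀ e ∈ r t, flipValue e ∈ R := fun t ht e he =>
    mem_biUnion ht
      (Finset.mem_coe.2 (Finset.mem_union_right _ (Finset.mem_image_of_mem _ he)))
  obtain ⟨J, -, hJ, hcard⟩ := exists_pairwise_le_mk (c := c)
    {i | ∃ t ∈ I, r t ⊆ p i ∧ ∀ e ∈ p i, e ∈ R → e ∈ r t}
    (fun i j => ValuesCompatible (p i) (p j)) (fun _ _ h => h.symm) (by
      intro J hJ hJc
      -- `θ t` must exceed `#T` as well, so that `p i` can avoid the prescriptions and flips of all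
      -- other roots.
      obtain ⟨t, ht, htν⟩ := hlim I hI (max (#J) (#T)) (max_lt hJc hTc)
      have hJt : #J < θ t := (le_max_left _ _).trans_lt htν
      have hB : #(R ∪ ⋃ i ∈ J, (((p i).image flipValue : Finset (Λ × Bool)) : Set (Λ × Bool)) :
          Set (Λ × Bool)) < θ t := by
        refine (mk_union_le _ _).trans_lt (add_lt_of_lt (hθ' t).le ?_ ?_)
        · exact mk_biUnion_finset_lt (hθ' t) I
            ((mk_set_le I).trans_lt ((le_max_right _ _).trans_lt htν)) _
        · exact mk_biUnion_finset_lt (hθ' t) J hJt _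
      have hJF : #((↑) ⁻¹' J : Set (F t)) < θ t :=
        (mk_preimage_of_injective _ _ Subtype.val_injective).trans_lt hJt
      obtain ⟨i, hi, hiJ⟩ := sdiff_nonempty_of_mk_lt_mk (hJF.trans_le (hr t _ hB))
      refine ⟨i, ⟨t, ht, hi.1, fun e he heR => hi.2 e he (Or.inl heR)⟩, hiJ, ?_⟩
      intro j hj e he hej
      have her : e ∈ r t := hi.2 e he (Or.inr (mem_biUnion_image_flipValue hj hej))
      obtain ⟨t', ht', -, ht'j⟩ := hJ hj
      have her' : flipValue e ∈ r t' := ht'j _ hej (hRflip t ht e her)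
      rcases eq_or_ne t t' with rfl | hne
      · exact hrc t e her her'
      · exact hIc ht ht' hne e her her')
  exact ⟨J, hcard, hJ⟩

/-- Successor alephs are regular, so those indexed along a cofinal set of order type `cf κ` serve as
the `θ t`. -/
theorem exists_pairwise_valuesCompatible_aleph {ι Λ : Type u} {κ : Cardinal.{u}}
    (hκ : κ < ℵ_ κ.ord) (hcof : ℵ₀ < κ.ord.cof) (hι : ℵ_ κ.ord ≤ #ι)
    (p : ι → Finset (Λ × Bool)) (hp : ∀ i, ValuesCompatible (p i) (p i)) :
    ∃ J : Set ι, ℵ_ κ.ord ≤ #J ∧ J.Pairwise fun i j => ValuesCompatible (p i) (p j) := by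
  have hlimκ : Order.IsSuccLimit κ.ord := Ordinal.one_lt_cof_iff.1 (one_lt_aleph0.trans hcof)
  obtain ⟨T, hTcof, hTtype⟩ := Ordinal.exists_ord_cof_eq κ.ord.ToType
  have hT : #T = κ.ord.cof := by
    have := congrArg Ordinal.card hTtype
    rwa [Ordinal.card_type, card_ord, Ordinal.cof_toType] at this
  have hTord : ord #T = Ordinal.type (α := T) (· < ·) := by
    rw [hTtype, hT, Ordinal.cof_toType]
  let o : T → Ordinal.{u} := fun t => (Ordinal.ToType.mk.symm t.1).1
  have ho : ∀ t, o t < κ.ord := fun t => (Ordinal.ToType.mk.symm t.1).2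
  refine exists_pairwise_valuesCompatible_of_limit (T := T) (hT ▸ isRegular_cof hlimκ)
    (hT ▸ hcof) (hT ▸ (Ordinal.cof_ord_le κ).trans_lt hκ) (fun t => ℵ_ (o t + 1))
    (fun t => isRegular_aleph_add_one _)
    (fun t => aleph_le_aleph.2 (Order.add_one_le_of_lt (ho t))) ?_
    (fun t => aleph0_lt_aleph.2 (by simp)) hι p hp
  intro I hI ν hν
  rw [aleph_limit hlimκ] at hν
  obtain ⟨⟨a, ha⟩, hνa⟩ := exists_lt_of_lt_ciSup' hν
  obtain ⟨t₀, ht₀, hat₀⟩ := hTcof (Ordinal.ToType.mk ⟨a, ha⟩)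
  -- The order type of `T` is an initial ordinal, so a subset of full size is unbounded.
  obtain ⟨t, htI, htt₀⟩ : ∃ t ∈ I, (⟨t₀, ht₀⟩ : T) ≤ t := by
    by_contra! hcon
    exact ((mk_le_mk_of_subset hcon).trans_lt (mk_Iio_lt _ hTord)).not_ge hI
  refine ⟨t, htI, hνa.trans (aleph_lt_aleph.2 ?_)⟩
  have h1 : Ordinal.ToType.mk ⟨a, ha⟩ ≤ (t : κ.ord.ToType) := hat₀.trans htt₀
  have h2 : (⟨a, ha⟩ : Iio κ.ord) ≤ Ordinal.ToType.mk.symm t.1 := by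
    rwa [OrderIso.le_symm_apply]
  exact Order.lt_add_one_iff.2 h2

/-! ### Open sets in the cube and in sums -/

/-- Any `ℵ_κ` many nonempty open subsets of a Cantor cube contain as many ones with a common
point. -/
theorem exists_nonempty_iInter_of_isOpen_pi_bool {ι Λ : Type u} {κ : Cardinal.{u}}
    (hκ : κ < ℵ_ κ.ord) (hcof : ℵ₀ < κ.ord.cof) (hι : ℵ_ κ.ord ≤ #ι)
    (U : ι → Set (Λ → Bool)) (hU : ∀ i, IsOpen (U i)) (hne : ∀ i, (U i).Nonempty) :
    ∃ J : Set ι, ℵ_ κ.ord ≤ #J ∧ (⋂ i ∈ J, U i).Nonempty := by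
  classical
  choose y hy using hne
  choose s u hu hsub using fun i => isOpen_pi_iff.1 (hU i) (y i) (hy i)
  let p : ι → Finset (Λ × Bool) := fun i => (s i).image fun a => (a, y i a)
  have hval : ∀ i, ∀ e ∈ p i, y i e.1 = e.2 := by
    intro i e he
    obtain ⟨a, -, rfl⟩ := Finset.mem_image.1 he
    rfl
  have hp : ∀ i, ValuesCompatible (p i) (p i) := by
    intro i e he hf
    have h := hval i _ hf
    rw [flipValue, hval i e he] at h
    exact Bool.self_ne_not _ h
  obtain ⟨J, hJ, hpair⟩ := exists_pairwise_valuesCompatible_aleph hκ hcof hι p hp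
  have hall : ∀ i ∈ J, ∀ j ∈ J, ValuesCompatible (p i) (p j) := by
    intro i hi j hj
    rcases eq_or_ne i j with rfl | hij
    exacts [hp i, hpair hi hj hij]
  let z : Λ → Bool := fun a => decide (∃ i ∈ J, (a, true) ∈ p i)
  refine ⟨J, hJ, z, mem_iInter₂.2 fun i hi => hsub i fun a ha => ?_⟩
  have hmem : (a, y i a) ∈ p i := Finset.mem_image_of_mem _ ha
  have hz : z a = y i a := by
    cases hya : y i a with
    | true => exact decide_eq_true ⟨i, hi, hya ▸ hmem⟩
    | false =>
      refine decide_eq_false ?_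
      rintro ⟨j, hj, hja⟩
      exact hall j hj i hi _ hja (by simpa [flipValue, hya] using hmem)
  rw [hz]
  exact (hu i a ha).2

/-- An open set is determined by the basic boxes it contains, and there are only `#Λ` finite
prescriptions. -/
theorem mk_opens_pi_bool_le (Λ : Type u) [Infinite Λ] :
    #(TopologicalSpace.Opens (Λ → Bool)) ≤ 2 ^ #Λ := by
  classical
  let f : TopologicalSpace.Opens (Λ → Bool) → Set (Finset (Λ × Bool)) :=
    fun U => {p | ∀ y : Λ → Bool, (∀ e ∈ p, y e.1 = e.2) → y ∈ U}
  have hle : ∀ U V, f U ⊆ f V → U ≤ V := by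
    intro U V hUV y hy
    obtain ⟨s, u, hu, hsub⟩ := isOpen_pi_iff.1 U.isOpen y hy
    refine hUV (a := s.image fun a => (a, y a)) (fun z hz => hsub fun a ha => ?_) y ?_
    · have : z a = y a := hz (a, y a) (Finset.mem_image_of_mem _ ha)
      rw [this]
      exact (hu a ha).2
    · intro e he
      obtain ⟨a, -, rfl⟩ := Finset.mem_image.1 he
      rfl
  have hinj : Function.Injective f := fun U V h =>
    le_antisymm (hle U V h.subset) (hle V U h.symm.subset)
  refine (mk_le_of_injective hinj).trans_eq ?_
  rw [mk_set, mk_finset_of_infinite]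
  congr 1
  have h2 : (2 : Cardinal.{u}) ≤ #Λ := (natCast_le_aleph0 (n := 2)).trans (aleph0_le_mk Λ)
  simpa using mul_eq_left (aleph0_le_mk Λ) h2 two_ne_zero

theorem mk_opens_sum_le (A B : Type u) [TopologicalSpace A] [TopologicalSpace B] :
    #(TopologicalSpace.Opens (A ⊕ B)) ≤
      #(TopologicalSpace.Opens A) * #(TopologicalSpace.Opens B) := by
  let f : TopologicalSpace.Opens (A ⊕ B) →
      TopologicalSpace.Opens A × TopologicalSpace.Opens B :=
    fun U => (⟨Sum.inl ⁻¹' (U : Set (A ⊕ B)), U.isOpen.preimage continuous_inl⟩,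
      ⟨Sum.inr ⁻¹' (U : Set (A ⊕ B)), U.isOpen.preimage continuous_inr⟩)
  have hf : Function.Injective f := by
    intro U V h
    have h1 : Sum.inl ⁻¹' (U : Set (A ⊕ B)) = Sum.inl ⁻¹' (V : Set (A ⊕ B)) :=
      congrArg (fun W => (W.1 : Set A)) h
    have h2 : Sum.inr ⁻¹' (U : Set (A ⊕ B)) = Sum.inr ⁻¹' (V : Set (A ⊕ B)) :=
      congrArg (fun W => (W.2 : Set B)) h
    ext x
    cases x with
    | inl a => exact Set.ext_iff.1 h1 a
    | inr b => exact Set.ext_iff.1 h2 b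
  simpa using mk_le_of_injective hf

theorem mk_le_mk_opens (X : Type u) [TopologicalSpace X] [T1Space X] :
    #X ≤ #(TopologicalSpace.Opens X) :=
  mk_le_of_injective (f := fun x : X => (⟨{x}ᶜ, isOpen_compl_singleton⟩ :
    TopologicalSpace.Opens X)) fun x y h => by
      simpa using congrArg (fun U : TopologicalSpace.Opens X => (U : Set X)) h

/-- If `A` has fewer than `ℵ_κ` open sets, then `ℵ_κ` is a caliber* of the sum of `A` and a
Cantor cube. -/
theorem isCaliberStar_sum_pi_bool {A Λ : Type u} [TopologicalSpace A] {κ : Cardinal.{u}}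
    (hκ : κ < ℵ_ κ.ord) (hcof : ℵ₀ < κ.ord.cof) (hA : (2 : Cardinal.{u}) ^ #A < ℵ_ κ.ord) :
    IsCaliberStar (A ⊕ (Λ → Bool)) (ℵ_ κ.ord) := by
  intro 𝒰 h𝒰 hcard
  let 𝒲 : Set (Set (A ⊕ (Λ → Bool))) := {U ∈ 𝒰 | (Sum.inr ⁻¹' U).Nonempty}
  have hrest : #(𝒰 \ 𝒲 : Set (Set (A ⊕ (Λ → Bool)))) < ℵ_ κ.ord := by
    refine lt_of_le_of_lt ?_ (mk_set.trans_lt hA)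
    refine mk_le_of_injective (f := fun U => (Sum.inl ⁻¹' U.1 : Set A)) ?_
    rintro ⟨U, hU, hU'⟩ ⟨V, hV, hV'⟩ (h : Sum.inl ⁻¹' U = Sum.inl ⁻¹' V)
    have hU'' : Sum.inr ⁻¹' U = ∅ := not_nonempty_iff_eq_empty.1 fun hn => hU' ⟨hU, hn⟩
    have hV'' : Sum.inr ⁻¹' V = ∅ := not_nonempty_iff_eq_empty.1 fun hn => hV' ⟨hV, hn⟩
    refine Subtype.ext (Set.ext fun x => ?_)
    cases x with
    | inl a => exact Set.ext_iff.1 h a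
    | inr b => exact Set.ext_iff.1 (hU''.trans hV''.symm) b
  have h𝒲 : ℵ_ κ.ord ≤ #𝒲 := by
    by_contra! hlt
    have : #𝒰 ≤ #𝒲 + #(𝒰 \ 𝒲 : Set (Set (A ⊕ (Λ → Bool)))) := by
      refine (mk_le_mk_of_subset ?_).trans (mk_union_le _ _)
      exact fun U hU => (em (U ∈ 𝒲)).imp id fun h => ⟨hU, h⟩
    exact (this.trans_lt (add_lt_of_lt (aleph0_le_aleph _) hlt hrest)).ne hcard
  obtain ⟨J, hJ, x, hx⟩ := exists_nonempty_iInter_of_isOpen_pi_bool hκ hcof h𝒲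
    (fun U => Sum.inr ⁻¹' U.1) (fun U => (h𝒰 _ U.2.1).1.preimage continuous_inr)
    (fun U => U.2.2)
  have hsub : Subtype.val '' J ⊆ 𝒰 := by
    rintro _ ⟨U, -, rfl⟩
    exact U.2.1
  refine ⟨Subtype.val '' J, hsub, ?_, Sum.inr x, ?_⟩
  · refine le_antisymm ((mk_le_mk_of_subset hsub).trans_eq hcard) ?_
    rwa [mk_image_eq Subtype.val_injective]
  · rintro _ ⟨U, hU, rfl⟩
    exact mem_iInter₂.1 hx U hU

/-! ### Failure of the weak precalibers -/

theorem aleph_ord_le_sum_toType {κ : Cardinal.{u}} (hκ : ℵ₀ ≤ κ) :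
    ℵ_ κ.ord ≤ Cardinal.sum fun i : κ.ord.ToType => ℵ_ (Ordinal.ToType.mk.symm i).1 := by
  refine le_of_forall_lt fun ν hν => ?_
  rw [aleph_limit (isSuccLimit_ord hκ)] at hν
  obtain ⟨a, hνa⟩ := exists_lt_of_lt_ciSup' hν
  refine hνa.trans_le ?_
  simpa using le_sum (fun i : κ.ord.ToType => ℵ_ (Ordinal.ToType.mk.symm i).1)
    (Ordinal.ToType.mk a)

/-- A family of `κ` many pairwise disjoint nonempty open sets, suitably repeated, refutes that
`ℵ_κ` is a weak precaliber. -/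
theorem not_isWeakPrecaliber_aleph {X : Type u} [TopologicalSpace X] {κ : Cardinal.{u}}
    (hκ : ℵ₀ ≤ κ) (V : κ.ord.ToType → Set X) (hV : ∀ i, IsOpen (V i) ∧ (V i).Nonempty)
    (hdisj : Pairwise fun i j => Disjoint (V i) (V j)) :
    ¬ IsWeakPrecaliber X (ℵ_ κ.ord) := by
  intro h
  let S := Σ i : κ.ord.ToType, (ℵ_ (Ordinal.ToType.mk.symm i).1).out
  obtain ⟨g⟩ : Nonempty ((ℵ_ κ.ord).ord.ToType ↪ S) := by
    rw [← le_def, mk_sigma, mk_ord_toType]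
    simpa using aleph_ord_le_sum_toType hκ
  obtain ⟨J, hJ, hlink⟩ := h (fun α => V (g α).1) fun α => hV _
  obtain ⟨⟨α₀, hα₀⟩⟩ := mk_ne_zero_iff.1 (hJ.trans_ne (aleph_pos _).ne')
  -- Linked members cannot come from disjoint sets, so `J` sits in one fibre, of size `ℵ_i` with `i
  -- < κ`.
  have hfib : ∀ α ∈ J, (g α).1 = (g α₀).1 := by
    intro α hα
    by_contra hne
    exact (not_disjoint_iff_nonempty_inter.2
      (hlink _ (mem_image_of_mem _ hα) _ (mem_image_of_mem _ hα₀))) (hdisj hne)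
  have hle : #J ≤ ℵ_ (Ordinal.ToType.mk.symm (g α₀).1).1 := by
    have hrange : g '' J ⊆ range fun x => (⟨(g α₀).1, x⟩ : S) := by
      rintro _ ⟨α, hα, rfl⟩
      rw [← hfib α hα]
      exact ⟨(g α).2, rfl⟩
    rw [← mk_image_eq (s := J) g.injective]
    exact ((mk_le_mk_of_subset hrange).trans mk_range_le).trans_eq (mk_out _)
  rw [hJ, aleph_le_aleph] at hle
  exact hle.not_gt (Ordinal.ToType.mk.symm (g α₀).1).2

/-- `κ` many pairwise disjoint nonempty open sets refute that `κ` is a weak precaliber*. -/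
theorem not_isWeakPrecaliberStar_of_pairwise_disjoint {X D : Type u} [TopologicalSpace X]
    (hD : 1 < #D) (V : D → Set X) (hV : ∀ i, IsOpen (V i) ∧ (V i).Nonempty)
    (hdisj : Pairwise fun i j => Disjoint (V i) (V j)) :
    ¬ IsWeakPrecaliberStar X #D := by
  intro h
  have hinj : Function.Injective V := by
    intro i j hij
    by_contra hne
    have : Disjoint (V i) (V j) := hdisj hne
    rw [hij, disjoint_self] at this
    exact (hV j).2.ne_empty this
  obtain ⟨𝒱, h𝒱, hcard, hlink⟩ := h (range V) (by rintro _ ⟨i, rfl⟩; exact hV i)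
    (mk_range_eq V hinj)
  obtain ⟨⟨A, hA⟩, ⟨B, hB⟩, hAB⟩ := one_lt_iff_nontrivial.1 (hcard.symm ▸ hD)
  obtain ⟨i, rfl⟩ := h𝒱 hA
  obtain ⟨j, rfl⟩ := h𝒱 hB
  refine (not_disjoint_iff_nonempty_inter.2 (hlink _ hA _ hB)) (hdisj ?_)
  rintro rfl
  exact hAB rfl

/-! ### Assembling the example -/

theorem mainTheorem1 (κ : Cardinal.{u}) (hκ : Cardinal.aleph0 ≤ κ)
    (hpow : (2 : Cardinal.{u}) ^ κ < Cardinal.aleph κ.ord)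
    (hcof : Cardinal.aleph0 < κ.ord.cof) :
    ∃ (X : Type u) (_ : TopologicalSpace X), CompactSpace X ∧ T2Space X ∧
      #(TopologicalSpace.Opens X) = (2 : Cardinal.{u}) ^ Cardinal.aleph κ.ord ∧
      #X = (2 : Cardinal.{u}) ^ Cardinal.aleph κ.ord ∧
      IsCaliberStar X (Cardinal.aleph κ.ord) ∧
      ¬ IsWeakPrecaliber X (Cardinal.aleph κ.ord) ∧
      ¬ IsWeakPrecaliberStar X κ := by
  have hlt : κ < ℵ_ κ.ord := (cantor κ).trans hpow
  have hinf : ℵ₀ ≤ ℵ_ κ.ord := aleph0_le_aleph _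
  let : TopologicalSpace κ.ord.ToType := ⊥
  have : DiscreteTopology κ.ord.ToType := ⟨rfl⟩
  let D := κ.ord.ToType
  let Λ := (ℵ_ κ.ord).ord.ToType
  have hΛ : #Λ = ℵ_ κ.ord := mk_ord_toType _
  have : Infinite Λ := infinite_iff.2 (hΛ ▸ hinf)
  have hD : #(OnePoint D) = κ := by
    change #(Option D) = κ
    rw [mk_option, mk_ord_toType, add_one_eq hκ]
  have hcube : #(Λ → Bool) = 2 ^ ℵ_ κ.ord := by simp [hΛ]
  have hX : #(OnePoint D ⊕ (Λ → Bool)) = 2 ^ ℵ_ κ.ord := by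
    rw [mk_sum, lift_id, lift_id, hD, hcube]
    exact add_eq_right (hinf.trans (cantor _).le) (hlt.trans (cantor _)).le
  have hopens : #(TopologicalSpace.Opens (OnePoint D ⊕ (Λ → Bool))) = 2 ^ ℵ_ κ.ord := by
    refine le_antisymm ((mk_opens_sum_le _ _).trans ?_) (hX.ge.trans (mk_le_mk_opens _))
    have h1 : #(TopologicalSpace.Opens (OnePoint D)) ≤ 2 ^ ℵ_ κ.ord := by
      refine (mk_le_of_injective (f := fun U : TopologicalSpace.Opens (OnePoint D) =>
        (U : Set (OnePoint D))) SetLike.coe_injective).trans ?_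
      rw [mk_set, hD]
      exact hpow.le.trans (cantor _).le
    have h2 : #(TopologicalSpace.Opens (Λ → Bool)) ≤ 2 ^ ℵ_ κ.ord :=
      (mk_opens_pi_bool_le Λ).trans_eq (by rw [hΛ])
    exact mul_le_of_le (hinf.trans (cantor _).le) h1 h2
  let V : D → Set (OnePoint D ⊕ (Λ → Bool)) := fun d => {Sum.inl (d : OnePoint D)}
  have hV : ∀ d, IsOpen (V d) ∧ (V d).Nonempty := by
    refine fun d => ⟨?_, singleton_nonempty _⟩
    have : V d = Sum.inl '' ((↑) '' {d} : Set (OnePoint D)) := by simp [V]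
    rw [this]
    exact isOpenMap_inl _ (OnePoint.isOpen_image_coe.2 (isOpen_discrete _))
  have hdisj : Pairwise fun i j => Disjoint (V i) (V j) := by
    intro i j hij
    simpa [V] using hij
  refine ⟨OnePoint D ⊕ (Λ → Bool), inferInstance, inferInstance, inferInstance, hopens, hX,
    isCaliberStar_sum_pi_bool hlt hcof (by rwa [hD]), not_isWeakPrecaliber_aleph hκ V hV hdisj, ?_⟩
  have hD' : #D = κ := mk_ord_toType κ
  have := not_isWeakPrecaliberStar_of_pairwise_disjoint
    (hD' ▸ one_lt_aleph0.trans_le hκ) V hV hdisj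
  rwa [hD'] at this
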